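/- **Setting.** Let $\{0,1\}^*$ be the set of finite binary strings and let $\ell$ be a polynomial with integer coefficients such that $\ell(n)>0$ for all $n\in\mathbb{N}^+$. An *$\ell$-function* is a function $H\colon\mathbb{N}\times\{0,1\}^*\to\{0,1\}^*$ with $|H(n,x)|=\ell(n)$ for all $n,x$ (if $\ell(0)<0$, this is read as $|H(0,x)|=0$ for $n=0$); write $H_n(x)=H(n,x)$. It is *computable* if some Turing machine halts on every input $(n,x)$ with output $H(n,x)$. A *probabilistic polynomial-time algorithm* is a probabilistic multi-tape oracle Turing machine that, for some fixed $k$, is executed for at most $L^k+k$ steps, where $L$ is the total length of its inputs; an oracle call is one step. A *signature scheme relative to $\ell$-functions* is a triple $\Pi=(\mathsf{Gen},\mathsf{Sign},\mathsf{Vrfy})$ of polynomial-time algorithms: $\mathsf{Gen}$ is probabilistic, has no oracle, and on input $1^n$ outputs a key pair $(pk,sk)$, where $n$ is determined by each of $pk$ and $sk$; $\mathsf{Sign}$ is probabilistic, has oracle access to $H_n$, and on input $sk$ and a message $m\in\{0,1\}^*$ outputs a signature; $\mathsf{Vrfy}$ is deterministic, has oracle access to $H_n$, and on input $(pk,m,\sigma)$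 outputs a bit. It is required that for every $\ell$-function $H$, every $n\in\mathbb{N}^+$, every $(pk,sk)$ output by $\mathsf{Gen}(1^n)$ and every $m\in\{0,1\}^*$, always $\mathsf{Vrfy}^{H_n}_{pk}(m,\mathsf{Sign}^{H_n}_{sk}(m))=1$. For an adversary (probabilistic polynomial-time algorithm) $\mathcal{A}$, $n\in\mathbb{N}^+$ and a function $G$ with values in $\{0,1\}^{\ell(n)}$, the experiment $\mathsf{Sig\text{-}forge}_{\mathcal{A},\Pi}(n,G)$ runs $\mathsf{Gen}(1^n)$ to get $(pk,sk)$, runs $\mathcal{A}$ on input $pk$ with oracle access to $G$ and to $\mathsf{Sign}^{G}_{sk}(\cdot)$ (with fresh coins in each call), and lets $(m,\sigma)$ be the output of $\mathcal{A}$; the result is $1$ if $\mathcal{A}$ did not request a signature on $m$ and $\mathsf{Vrfy}^{G}_{pk}(m,\sigma)=1$, and $0$ otherwise. The function $G$ only has to be defined on $\{0,1\}^{\le q(n)}$ (the strings of length at most $q(n)$), where $q(n)$ is the maximum of the running times of $\mathsf{Sign}$, $\mathsf{Vrfy}$ and $\mathcal{A}$ on the parameter $n$, i.e. in this experiment, over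 all choices of $G$ and of the coins. Fix the recursive enumeration $\mathcal{A}_1,\mathcal{A}_2,\dots$ of all probabilistic polynomial-time adversaries that is given by a standard coding of the pairs (machine, $k$), and let $q_i(n)$ be $q(n)$ for $\mathcal{A}=\mathcal{A}_i$. Let $\mathsf{Func}_{\le q}^{m}$ be the set of all functions from $\{0,1\}^{\le q}$ to $\{0,1\}^m$. * $\Pi$ is *effectively EUF-ACMA secure in the random oracle model* if there is a computable function $f\colon\mathbb{N}^+\times\mathbb{N}^+\to\mathbb{N}^+$ such that for all $i,d,n\in\mathbb{N}^+$ with $n\ge f(i,d)$, $$\frac{1}{\#\mathsf{Func}_{\le q_i(n)}^{\ell(n)}}\sum_{G\in\mathsf{Func}_{\le q_i(n)}^{\ell(n)}}\Pr[\mathsf{Sig\text{-}forge}_{\mathcal{A}_i,\Pi}(n,G)=1]\le\frac{1}{n^d}.$$ * For an $\ell$-function $H$, $\Pi$ is *effectively EUF-ACMA secure relative to $H$* if there is a computable function $f\colon\mathbb{N}^+\times\mathbb{N}^+\to\mathbb{N}^+$ such that for all $i,d,n\in\mathbb{N}^+$ with $n\ge f(i,d)$, $$\Pr[\mathsf{Sig\text{-}forge}_{\mathcal{A}_i,\Pi}(n,H_n)=1]\le\frac{1}{n^d}.$$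 **Theorem.** Let $\ell$ be a polynomial as above. Suppose that a signature scheme $\Pi$ relative to $\ell$-functions is effectively EUF-ACMA secure in the random oracle model. Then there exists a computable $\ell$-function $H$ such that $\Pi$ is effectively EUF-ACMA secure relative to $H$. -/

import Mathlib

/-! ### Probabilistic oracle Turing machines

A machine has finitely many one-way infinite tapes over the alphabet {blank, 0, 1}, and two
transition functions. In every step a fair coin decides which one of the two is applied. -/

/-- Finite binary strings. -/
abbrev Str : Type := List Bool

/-- Tape symbols; `none` is the blank. -/
abbrev TapeSymbol : Type := Option Bool

/-- A one-way infinite tape: the cells to the left of the head (nearest first), and the cells from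
the head on. All cells that are not listed are blank. -/
abbrev Tape : Type := List TapeSymbol × List TapeSymbol

/-- Head moves: `none` stay, `some false` left, `some true` right. -/
abbrev HeadMove : Type := Option Bool

/-- The symbol under the head. -/
def tapeRead (t : Tape) : TapeSymbol := t.2.headD none

/-- Write a symbol at the head. -/
def tapeWrite (a : TapeSymbol) (t : Tape) : Tape := (t.1, a :: t.2.tail)

/-- Move the head; a left move on the leftmost cell has no effect. -/
def tapeMove : HeadMove → Tape → Tape
  | none, t => t
  | some true, (l, r) => (r.headD none :: l, r.tail)
  | some false, ([], r) => ([], r)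
  | some false, (a :: l, r) => (l, a :: r)

/-- The bits before the first blank. -/
def leadingBits : List TapeSymbol → Str
  | some b :: l => b :: leadingBits l
  | _ => []

/-- The string written on a tape, from its leftmost cell to the first blank. -/
def tapeString (t : Tape) : Str := leadingBits (t.1.reverse ++ t.2)

/-- The tape that contains just `x`, with the head on the leftmost cell. -/
def loadTape (x : Str) : Tape := ([], x.map some)

/-- A pair of transition functions as one finite table. An entry
`((s, c, reads), (s', acts))` says: in state `s`, if the coin shows `c` and the tapes read `reads`,
go to state `s'` and, on the `j`-th tape, write and move as the `j`-th item of `acts` tells. -/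
abbrev TransitionTable : Type :=
  List ((ℕ × Bool × List TapeSymbol) × (ℕ × List (TapeSymbol × HeadMove)))

/-- A probabilistic oracle Turing machine: the number of its work tapes, and its table.
It has seven further tapes: 0, 1, 2 are the input tapes, 3 and 4 the output tapes, 5 is the query
tape and 6 the answer tape. Tapes 7, 8, … are the work tapes.
State 0 is the initial state and state 1 the halting state. In state 2 the hash oracle is called
(then the machine is in state 3), in state 4 the signing oracle is called (then the machine is in
state 5). All other states are ordinary ones. -/
abbrev Machine : Type := ℕ × TransitionTable

/-- A configuration: the state, the tapes, and the list of the messages that have been sent to the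
signing oracle so far (the list is kept for the experiment; the machine cannot access it). -/
abbrev Cfg : Type := ℕ × List Tape × List Str

/-- The string on tape `j`. -/
def cfgString (c : Cfg) (j : ℕ) : Str := tapeString (c.2.1.getD j ([], []))

/-- Write and move on all the tapes. -/
def applyActions (ts : List Tape) (acts : List (TapeSymbol × HeadMove)) : List Tape :=
  (List.range ts.length).map fun j =>
    match acts[j]? with
    | none => ts.getD j ([], [])
    | some (a, mv) => tapeMove mv (tapeWrite a (ts.getD j ([], [])))

/-- One step. `O` is the hash oracle, `S j` is the signing oracle at its `j`-th call, and `coin` is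
the outcome of the coin toss of this step. An oracle call is one step; it puts the answer on the
answer tape. If the table has no applicable entry, then the machine halts. -/
def machineStep (M : Machine) (O : Str → Str) (S : ℕ → Str → Str) (coin : Bool) (c : Cfg) : Cfg :=
  if c.1 = 1 then c
  else if c.1 = 2 then
    (3, c.2.1.set 6 (loadTape (O (cfgString c 5))), c.2.2)
  else if c.1 = 4 then
    (5, c.2.1.set 6 (loadTape (S c.2.2.length (cfgString c 5))), c.2.2 ++ [cfgString c 5])
  else
    match M.2.lookup (c.1, coin, c.2.1.map tapeRead) with
    | none => (1, c.2)
    | some (s, acts) => (s, applyActions c.2.1 acts, c.2.2)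

/-- The initial configuration, with the given strings on the input tapes. -/
def initialCfg (M : Machine) (inputs : List Str) : Cfg :=
  (0, (List.range (7 + M.1)).map (fun j => loadTape (inputs.getD j [])), [])

/-- The configuration after `t` steps; `coins t` is the coin toss of step number `t`. -/
def machineRun (M : Machine) (O : Str → Str) (S : ℕ → Str → Str) (coins : ℕ → Bool)
    (inputs : List Str) : ℕ → Cfg
  | 0 => initialCfg M inputs
  | t + 1 => machineStep M O S (coins t) (machineRun M O S coins inputs t)

/-- A machine is deterministic if its two transition functions coincide. -/
def Machine.Deterministic (M : Machine) : Prop :=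
  ∀ (s : ℕ) (reads : List TapeSymbol),
    M.2.lookup (s, false, reads) = M.2.lookup (s, true, reads)

/-- A probabilistic polynomial-time algorithm: a machine `M` together with a number `k`. On inputs
of total length `L`, the machine is executed for at most `L ^ k + k` steps. -/
abbrev PolyTimeAlg : Type := Machine × ℕ

/-- The maximal number of steps that the algorithm is executed for on the given inputs. -/
def PolyTimeAlg.clock (A : PolyTimeAlg) (inputs : List Str) : ℕ :=
  (inputs.map List.length).sum ^ A.2 + A.2

/-- The final configuration of an execution. -/
def PolyTimeAlg.exec (A : PolyTimeAlg) (O : Str → Str) (S : ℕ → Str → Str) (coins : ℕ → Bool)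
    (inputs : List Str) : Cfg :=
  machineRun A.1 O S coins inputs (PolyTimeAlg.clock A inputs)

/-- The running time of an execution: the number of steps until the machine halts or is stopped. -/
def PolyTimeAlg.time (A : PolyTimeAlg) (O : Str → Str) (S : ℕ → Str → Str) (coins : ℕ → Bool)
    (inputs : List Str) : ℕ :=
  Nat.count (fun t => (machineRun A.1 O S coins inputs t).1 ≠ 1) (PolyTimeAlg.clock A inputs)

/-- The oracle that is given to algorithms without access to a hash oracle. -/
def noHash : Str → Str := fun _ => []

/-- The oracle that is given to algorithms without access to a signing oracle. -/
def noSign : ℕ → Str → Str := fun _ _ => []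

/-- The standard recursive enumeration of all probabilistic polynomial-time adversaries. -/
def adversary (i : ℕ) : PolyTimeAlg := (Encodable.decode i).getD ((0, []), 0)

/-- Every probabilistic polynomial-time algorithm occurs in the enumeration. -/
theorem adversary_surjective : Function.Surjective adversary := fun A =>
  ⟨Encodable.encode A, by simp [adversary]⟩

/-! ### Signature schemes relative to `ℓ`-functions -/

/-- The length `ℓ(n)` as a natural number (the truncation can only matter for `n = 0`, since `ℓ`
will be positive on the positive integers). -/
noncomputable def outLen (ℓ : Polynomial ℤ) (n : ℕ) : ℕ := (ℓ.eval (n : ℤ)).toNat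

/-- `ℓ`-functions. -/
def IsEllFunction (ℓ : Polynomial ℤ) (H : ℕ → Str → Str) : Prop :=
  ∀ (n : ℕ) (x : Str), (H n x).length = outLen ℓ n

/-- The keys `(pk, sk)` that `gen` outputs on the security parameter `1^n`, for given coins. -/
def genKeys (gen : PolyTimeAlg) (n : ℕ) (coins : ℕ → Bool) : Str × Str :=
  let c := gen.exec noHash noSign coins [List.replicate n true]
  (cfgString c 3, cfgString c 4)

/-- The signature of `m` under the private key `sk`, with hash oracle `O`, for given coins. -/
def signOutput (sign : PolyTimeAlg) (O : Str → Str) (coins : ℕ → Bool) (sk m : Str) : Str :=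
  cfgString (sign.exec O noSign coins [sk, m]) 3

/-- `vrfy`, a deterministic algorithm, accepts the signature `σ` on `m`; that is, it outputs the
bit 1. (The coins have no influence.) -/
def Accepts (vrfy : PolyTimeAlg) (O : Str → Str) (pk m σ : Str) : Prop :=
  cfgString (vrfy.exec O noSign (fun _ => false) [pk, m, σ]) 3 = [true]

/-- A signature scheme relative to `ℓ`-functions. -/
structure SignatureScheme (ℓ : Polynomial ℤ) where
  /-- the key generation algorithm -/
  gen : PolyTimeAlg
  /-- the signing algorithm -/
  sign : PolyTimeAlg
  /-- the verification algorithm -/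
  vrfy : PolyTimeAlg
  vrfy_deterministic : Machine.Deterministic vrfy.1
  /-- `n` is determined by the public key -/
  pk_determines : ∀ (n n' : ℕ) (coins coins' : ℕ → Bool), 0 < n → 0 < n' →
    (genKeys gen n coins).1 = (genKeys gen n' coins').1 → n = n'
  /-- `n` is determined by the private key -/
  sk_determines : ∀ (n n' : ℕ) (coins coins' : ℕ → Bool), 0 < n → 0 < n' →
    (genKeys gen n coins).2 = (genKeys gen n' coins').2 → n = n'
  /-- honestly generated signatures are valid -/
  correct : ∀ H : ℕ → Str → Str, IsEllFunction ℓ H → ∀ n : ℕ, 0 < n →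
    ∀ (coins coins' : ℕ → Bool) (m : Str),
      Accepts vrfy (H n) (genKeys gen n coins).1 m
        (signOutput sign (H n) coins' (genKeys gen n coins).2 m)

/-! ### The signature experiment -/

/-- The outcomes of all the coin tosses of an experiment: `ω (0, t)` are the coins of the key
generation, `ω (1, t)` those of the adversary, and `ω (j + 2, t)` those of the signing algorithm at
the `j`-th call of the signing oracle. -/
abbrev CoinSpace : Type := ℕ × ℕ → Bool

/-- All the coin tosses are fair and independent. -/
noncomputable def coinMeasure : MeasureTheory.Measure CoinSpace :=
  MeasureTheory.Measure.infinitePi fun _ : ℕ × ℕ => (PMF.uniformOfFintype Bool).toMeasure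

namespace SignatureScheme

variable {ℓ : Polynomial ℤ}

/-- The keys in the experiment. -/
def exptKeys (P : SignatureScheme ℓ) (n : ℕ) (ω : CoinSpace) : Str × Str :=
  genKeys P.gen n fun t => ω (0, t)

/-- The signing oracle in the experiment. -/
def exptSigner (P : SignatureScheme ℓ) (n : ℕ) (G : Str → Str) (ω : CoinSpace)
    (j : ℕ) (m : Str) : Str :=
  signOutput P.sign G (fun t => ω (j + 2, t)) (P.exptKeys n ω).2 m

/-- The final configuration of the adversary in the experiment. It outputs a message on tape 3 and
a signature on tape 4. -/
def exptAdversary (P : SignatureScheme ℓ) (A : PolyTimeAlg) (n : ℕ) (G : Str → Str)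
    (ω : CoinSpace) : Cfg :=
  A.exec G (P.exptSigner n G ω) (fun t => ω (1, t)) [(P.exptKeys n ω).1]

/-- The experiment outputs 1: the adversary has output a message that it did not send to the
signing oracle, together with a valid signature. -/
def SigForge (P : SignatureScheme ℓ) (A : PolyTimeAlg) (n : ℕ) (G : Str → Str)
    (ω : CoinSpace) : Prop :=
  let c := P.exptAdversary A n G ω
  cfgString c 3 ∉ c.2.2 ∧ Accepts P.vrfy G (P.exptKeys n ω).1 (cfgString c 3) (cfgString c 4)

/-- The probability that the experiment outputs 1. -/
noncomputable def forgeProb (P : SignatureScheme ℓ) (A : PolyTimeAlg) (n : ℕ)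
    (G : Str → Str) : ℝ :=
  coinMeasure.real {ω | P.SigForge A n G ω}

/-- The running times, in one execution of the experiment, of the adversary, of the verification
algorithm, and of the signing algorithm at its calls. -/
def exptTimes (P : SignatureScheme ℓ) (A : PolyTimeAlg) (n : ℕ) (G : Str → Str)
    (ω : CoinSpace) : Set ℕ :=
  let pk := (P.exptKeys n ω).1
  let sk := (P.exptKeys n ω).2
  let c := P.exptAdversary A n G ω
  {t | t = A.time G (P.exptSigner n G ω) (fun s => ω (1, s)) [pk] ∨
    t = P.vrfy.time G noSign (fun _ => false) [pk, cfgString c 3, cfgString c 4] ∨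
    ∃ (j : ℕ) (m : Str), c.2.2[j]? = some m ∧
      t = P.sign.time G noSign (fun s => ω (j + 2, s)) [sk, m]}

/-- The maximum `q(n)` of the running times of the signing algorithm, the verification algorithm
and the adversary on the parameter `n`, over all hash functions with values in `{0,1}^ℓ(n)` and
all outcomes of the coin tosses. -/
noncomputable def maxTime (P : SignatureScheme ℓ) (A : PolyTimeAlg) (n : ℕ) : ℕ :=
  sSup {t | ∃ (G : Str → Str) (ω : CoinSpace),
    (∀ x, (G x).length = outLen ℓ n) ∧ t ∈ P.exptTimes A n G ω}

end SignatureScheme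

/-! ### Effective security -/

/-- The set `{0,1}^{≤ q}`. -/
abbrev StrLE (q : ℕ) : Type := {x : Str // x.length ≤ q}

noncomputable instance StrLE.fintype (q : ℕ) : Fintype (StrLE q) :=
  (List.finite_length_le Bool q).fintype

/-- The set of all functions from `{0,1}^{≤ q}` to `{0,1}^m`. -/
abbrev FuncLE (q m : ℕ) : Type := StrLE q → List.Vector Bool m

/-- A function on `{0,1}^{≤ q}` as an oracle. (Longer strings are never queried in its use below;
the answer to them is set to `0^m`.) -/
def FuncLE.toOracle {q m : ℕ} (G : FuncLE q m) (x : Str) : Str :=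
  if h : x.length ≤ q then (G ⟨x, h⟩).toList else List.replicate m false

namespace SignatureScheme

variable {ℓ : Polynomial ℤ}

/-- Effective EUF-ACMA security relative to the `ℓ`-function `H`. -/
def EffSecureRelativeTo (P : SignatureScheme ℓ) (H : ℕ → Str → Str) : Prop :=
  ∃ f : ℕ → ℕ → ℕ, Computable₂ f ∧ ∀ i d n : ℕ, 0 < d → 0 < n → f i d ≤ n →
    P.forgeProb (adversary i) n (H n) ≤ 1 / (n : ℝ) ^ d

/-- Effective EUF-ACMA security in the random oracle model. -/
def EffSecureInROM (P : SignatureScheme ℓ) : Prop :=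
  ∃ f : ℕ → ℕ → ℕ, Computable₂ f ∧ ∀ i d n : ℕ, 0 < d → 0 < n → f i d ≤ n →
    1 / (Fintype.card (FuncLE (P.maxTime (adversary i) n) (outLen ℓ n)) : ℝ) *
      ∑ G : FuncLE (P.maxTime (adversary i) n) (outLen ℓ n),
        P.forgeProb (adversary i) n G.toOracle ≤ 1 / (n : ℝ) ^ d

end SignatureScheme

/-!
The proof is an effective version of the probabilistic method. Fix `n`. A pair of an adversary `i`
and an exponent `d`, coded by the number `j`, is *due* at `n` if `j < n` and security in the random
oracle model already gives the average success probability at most `n ^ -(d + j + 1)` at `n`. The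
average of `n ^ d` times the success probability is then at most `2 ^ -(j + 1)`, and these numbers
add up to less than 1. So some single hash function gives every due pair a success probability of at
most `n ^ -d` (`SignatureScheme.exists_forall_forgeProb_le`). To speak of one hash function for
several adversaries, the averages over functions on strings of different maximal lengths have to
be compared. This is possible since a query is written bit by bit, so that the experiment never asks
for the hash value of a string longer than its running time
(`PolyTimeAlg.exec_congr_hash`, `SignatureScheme.sigForge_congr_hash`,
`SignatureScheme.average_forgeProb_eq`).

It remains to find the hash function by a computation. Only finitely many of its values matter, so
it can be given by a finite table, and one searches through all tables. The condition on a table is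
decidable: the experiment uses a bounded number of coins, so that the success probability is a
finite count divided by a power of two (`SignatureScheme.forgeProb_eq_count`), and executions of
machines are primitive recursive in all the data (`primrec_machineRun`,
`SignatureScheme.primrecPred_forgeProb_le`). The given function `f`, which tells when a pair is due,
is merely computable; so is the resulting search (`Computable.exists_choice_of_due`). A pair that is
due at `n` and has a code below `n` is taken care of at `n`, which yields the computable bound for
the security relative to the hash function found.
-/

/-! ### Executions of machines -/

/-- Two executions agree as long as they see the same coins and the same oracle answers. -/
theorem machineRun_congr (M : Machine) {O O' : Str → Str} {S S' : ℕ → Str → Str}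
    {coins coins' : ℕ → Bool} (inputs : List Str) (T : ℕ)
    (hc : ∀ t < T, coins t = coins' t)
    (hO : ∀ t < T, (machineRun M O S coins inputs t).1 = 2 →
      O (cfgString (machineRun M O S coins inputs t) 5) =
        O' (cfgString (machineRun M O S coins inputs t) 5))
    (hS : ∀ t < T, (machineRun M O S coins inputs t).1 = 4 →
      S (machineRun M O S coins inputs t).2.2.length
          (cfgString (machineRun M O S coins inputs t) 5) =
        S' (machineRun M O S coins inputs t).2.2.length
          (cfgString (machineRun M O S coins inputs t) 5)) :
    ∀ t ≤ T, machineRun M O S coins inputs t = machineRun M O' S' coins' inputs t := by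
  intro t
  induction t with
  | zero => intro _; rfl
  | succ t ih =>
    intro ht
    have h1 := ih (by omega)
    change machineStep M O S (coins t) (machineRun M O S coins inputs t) =
      machineStep M O' S' (coins' t) (machineRun M O' S' coins' inputs t)
    rw [← h1, ← hc t (by omega)]
    have h2 := hO t (by omega)
    have h3 := hS t (by omega)
    generalize machineRun M O S coins inputs t = c at *
    unfold machineStep
    split_ifs with a b d
    · rfl
    · rw [h2 b]
    · rw [h3 d]
    · rfl

/-- The number of the nonblank cells of a tape. -/
def nonblankCells (t : Tape) : ℕ := t.1.countP Option.isSome + t.2.countP Option.isSome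

theorem length_leadingBits_le (l : List TapeSymbol) :
    (leadingBits l).length ≤ l.countP Option.isSome := by
  induction l with
  | nil => simp [leadingBits]
  | cons a l ih => cases a <;> simp [leadingBits, ih]

theorem length_tapeString_le (t : Tape) : (tapeString t).length ≤ nonblankCells t := by
  refine (length_leadingBits_le _).trans ?_
  simp [nonblankCells, List.countP_append]

theorem nonblankCells_tapeMove (mv : HeadMove) (t : Tape) :
    nonblankCells (tapeMove mv t) = nonblankCells t := by
  obtain ⟨l, r⟩ := t
  match mv, l, r with
  | none, _, _ => rfl
  | some true, _, [] => simp [tapeMove, nonblankCells]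
  | some true, _, a :: r => simp [tapeMove, nonblankCells, List.countP_cons]; omega
  | some false, [], _ => rfl
  | some false, a :: l, _ => simp [tapeMove, nonblankCells, List.countP_cons]; omega

theorem nonblankCells_tapeWrite_le (a : TapeSymbol) (t : Tape) :
    nonblankCells (tapeWrite a t) ≤ nonblankCells t + 1 := by
  obtain ⟨l, r⟩ := t
  cases r <;> simp [tapeWrite, nonblankCells, List.countP_cons] <;> split_ifs <;> omega

theorem nonblankCells_applyActions_le (ts : List Tape) (acts : List (TapeSymbol × HeadMove))
    (j : ℕ) : nonblankCells ((applyActions ts acts).getD j ([], [])) ≤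
      nonblankCells (ts.getD j ([], [])) + 1 := by
  by_cases hj : j < ts.length
  · rw [applyActions, List.getD_eq_getElem _ _ (by simpa using hj)]
    simp only [List.getElem_map, List.getElem_range]
    split
    · omega
    · rw [nonblankCells_tapeMove]
      exact nonblankCells_tapeWrite_le _ _
  · rw [applyActions, List.getD_eq_default _ _ (by simpa using hj)]
    simp [nonblankCells]

/-- In each step, at most one more cell becomes nonblank on every tape but the answer tape. -/
theorem nonblankCells_machineRun_le (M : Machine) (O : Str → Str) (S : ℕ → Str → Str)
    (coins : ℕ → Bool) (inputs : List Str) {j : ℕ} (hj : j ≠ 6) (t : ℕ) :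
    nonblankCells ((machineRun M O S coins inputs t).2.1.getD j ([], [])) ≤
      (inputs.getD j []).length + t := by
  induction t with
  | zero =>
    by_cases h : j < 7 + M.1
    · rw [machineRun, initialCfg, List.getD_eq_getElem _ _ (by simpa using h)]
      simp only [List.getElem_map, List.getElem_range, loadTape, nonblankCells]
      refine le_trans (b := ((inputs.getD j []).map some).length) ?_ (by simp)
      simpa using List.countP_le_length
    · rw [machineRun, initialCfg, List.getD_eq_default _ _ (by simpa using h)]
      simp [nonblankCells]
  | succ t ih =>
    rw [machineRun]
    generalize machineRun M O S coins inputs t = c at *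
    unfold machineStep
    split_ifs with a b d
    · omega
    · simp only [List.getD_eq_getElem?_getD, List.getElem?_set_ne hj.symm] at ih ⊢; omega
    · simp only [List.getD_eq_getElem?_getD, List.getElem?_set_ne hj.symm] at ih ⊢; omega
    · split
      · simp only; omega
      · refine (nonblankCells_applyActions_le _ _ _).trans ?_
        omega

theorem length_cfgString_machineRun_le (M : Machine) (O : Str → Str) (S : ℕ → Str → Str)
    (coins : ℕ → Bool) (inputs : List Str) {j : ℕ} (hj : j ≠ 6) (hi : inputs.length ≤ j)
    (t : ℕ) : (cfgString (machineRun M O S coins inputs t) j).length ≤ t := by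
  have h := nonblankCells_machineRun_le M O S coins inputs hj t
  rw [List.getD_eq_default _ _ hi] at h
  exact (length_tapeString_le _).trans (by simpa using h)

theorem messages_machineRun_succ (M : Machine) (O : Str → Str) (S : ℕ → Str → Str)
    (coins : ℕ → Bool) (inputs : List Str) (t : ℕ) :
    (machineRun M O S coins inputs (t + 1)).2.2 =
      if (machineRun M O S coins inputs t).1 = 4 then (machineRun M O S coins inputs t).2.2 ++
        [cfgString (machineRun M O S coins inputs t) 5]
      else (machineRun M O S coins inputs t).2.2 := by
  rw [machineRun]
  generalize machineRun M O S coins inputs t = c at *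
  unfold machineStep
  split_ifs with a b d <;> first | rfl | (exfalso; omega) | skip
  split <;> rfl

theorem messages_machineRun_prefix (M : Machine) (O : Str → Str) (S : ℕ → Str → Str)
    (coins : ℕ → Bool) (inputs : List Str) {t t' : ℕ} (h : t ≤ t') :
    (machineRun M O S coins inputs t).2.2 <+: (machineRun M O S coins inputs t').2.2 := by
  induction t', h using Nat.le_induction with
  | base => exact List.prefix_rfl
  | succ t' _ ih =>
    refine ih.trans ?_
    rw [messages_machineRun_succ]
    split_ifs
    · exact List.prefix_append _ _
    · exact List.prefix_rfl

theorem length_messages_machineRun_le (M : Machine) (O : Str → Str) (S : ℕ → Str → Str)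
    (coins : ℕ → Bool) (inputs : List Str) (t : ℕ) :
    (machineRun M O S coins inputs t).2.2.length ≤ t := by
  induction t with
  | zero => simp [machineRun, initialCfg]
  | succ t ih =>
    rw [messages_machineRun_succ]
    split_ifs
    · simpa using ih
    · omega

theorem length_of_mem_messages_machineRun (M : Machine) (O : Str → Str) (S : ℕ → Str → Str)
    (coins : ℕ → Bool) (inputs : List Str) (hi : inputs.length ≤ 5) (t : ℕ) :
    ∀ m ∈ (machineRun M O S coins inputs t).2.2, m.length ≤ t := by
  induction t with
  | zero => simp [machineRun, initialCfg]
  | succ t ih =>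
    intro m hm
    rw [messages_machineRun_succ] at hm
    split_ifs at hm
    · rcases List.mem_append.1 hm with hm | hm
      · exact (ih m hm).trans (by omega)
      · rw [List.mem_singleton.1 hm]
        exact (length_cfgString_machineRun_le M O S coins inputs (by omega) hi t).trans (by omega)
    · exact (ih m hm).trans (by omega)

theorem machineRun_halted (M : Machine) (O : Str → Str) (S : ℕ → Str → Str)
    (coins : ℕ → Bool) (inputs : List Str) {t t' : ℕ} (h : t ≤ t')
    (ht : (machineRun M O S coins inputs t).1 = 1) :
    (machineRun M O S coins inputs t').1 = 1 := by
  induction t', h using Nat.le_induction with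
  | base => exact ht
  | succ t' _ ih => rw [machineRun, machineStep, if_pos ih]; exact ih

namespace PolyTimeAlg

theorem lt_time (A : PolyTimeAlg) (O : Str → Str) (S : ℕ → Str → Str) (coins : ℕ → Bool)
    (inputs : List Str) {t : ℕ} (ht : t < A.clock inputs)
    (h : (machineRun A.1 O S coins inputs t).1 ≠ 1) : t < A.time O S coins inputs := by
  unfold time
  refine lt_of_lt_of_le (Nat.lt_succ_self t) (le_trans ?_ (Nat.count_monotone _ ht))
  have hall : ∀ s < t.succ, (machineRun A.1 O S coins inputs s).1 ≠ 1 := fun s hs hs1 =>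
    h (machineRun_halted A.1 O S coins inputs (by omega) hs1)
  exact (Nat.count_iff_forall.2 hall).ge

theorem time_le_clock (A : PolyTimeAlg) (O : Str → Str) (S : ℕ → Str → Str) (coins : ℕ → Bool)
    (inputs : List Str) : A.time O S coins inputs ≤ A.clock inputs := by
  unfold time
  exact Nat.count_le _

theorem clock_le (A : PolyTimeAlg) {inputs : List Str} {L : ℕ}
    (h : (inputs.map List.length).sum ≤ L) : A.clock inputs ≤ L ^ A.2 + A.2 :=
  Nat.add_le_add_right (Nat.pow_le_pow_left h _) _

/-- An execution reads no more coins than its clock allows steps. -/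
theorem exec_congr_coins (A : PolyTimeAlg) (O : Str → Str) (S : ℕ → Str → Str)
    {coins coins' : ℕ → Bool} (inputs : List Str)
    (hc : ∀ t < A.clock inputs, coins t = coins' t) :
    A.exec O S coins inputs = A.exec O S coins' inputs :=
  machineRun_congr A.1 inputs _ hc (fun _ _ _ => rfl) (fun _ _ _ => rfl) _ le_rfl

/-- A query is written bit by bit, so it is shorter than the running time; hence an execution
depends only on the values of the hash oracle at arguments up to that length. -/
theorem exec_congr_hash (A : PolyTimeAlg) {O O' : Str → Str} {S S' : ℕ → Str → Str}
    (coins : ℕ → Bool) (inputs : List Str) (hi : inputs.length ≤ 5)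
    (hO : ∀ x : Str, x.length ≤ A.time O S coins inputs → O x = O' x)
    (hS : ∀ (j : ℕ) (m : Str), (A.exec O S coins inputs).2.2[j]? = some m → S j m = S' j m) :
    A.exec O S coins inputs = A.exec O' S' coins inputs := by
  refine machineRun_congr A.1 inputs _ (fun _ _ => rfl) (fun t ht h => hO _ ?_)
    (fun t ht h => hS _ _ ?_) _ le_rfl
  · exact (length_cfgString_machineRun_le A.1 O S coins inputs (by omega) hi t).trans
      (A.lt_time O S coins inputs ht (by omega)).le
  · have h1 : (machineRun A.1 O S coins inputs (t + 1)).2.2[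
        (machineRun A.1 O S coins inputs t).2.2.length]? =
        some (cfgString (machineRun A.1 O S coins inputs t) 5) := by
      rw [messages_machineRun_succ, if_pos h]; simp
    obtain ⟨w, hw⟩ := messages_machineRun_prefix A.1 O S coins inputs (Nat.succ_le_of_lt ht)
    change (machineRun A.1 O S coins inputs (A.clock inputs)).2.2[_]? = _
    rw [← hw, List.getElem?_append_left (List.getElem?_eq_some_iff.1 h1).1]
    exact h1

theorem length_cfgString_exec_le (A : PolyTimeAlg) (O : Str → Str) (S : ℕ → Str → Str)
    (coins : ℕ → Bool) (inputs : List Str) {j : ℕ} (hj : j ≠ 6) (hi : inputs.length ≤ j) :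
    (cfgString (A.exec O S coins inputs) j).length ≤ A.clock inputs :=
  length_cfgString_machineRun_le A.1 O S coins inputs hj hi _

end PolyTimeAlg

/-! ### Bounds on the experiment -/

namespace SignatureScheme

variable {ℓ : Polynomial ℤ}

/-- A bound on the running time of the key generation and on the lengths of the keys. -/
def genBound (P : SignatureScheme ℓ) (n : ℕ) : ℕ := n ^ P.gen.2 + P.gen.2

/-- A bound on the running time of the adversary, and hence on the number and the lengths of its
signature requests and on the lengths of its outputs. -/
def advBound (P : SignatureScheme ℓ) (A : PolyTimeAlg) (n : ℕ) : ℕ := P.genBound n ^ A.2 + A.2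

/-- A bound on the running time of the signing algorithm in the experiment. -/
def signBound (P : SignatureScheme ℓ) (A : PolyTimeAlg) (n : ℕ) : ℕ :=
  (P.genBound n + P.advBound A n) ^ P.sign.2 + P.sign.2

/-- The experiment uses only coins whose two indices are smaller than this number. -/
def coinBound (P : SignatureScheme ℓ) (A : PolyTimeAlg) (n : ℕ) : ℕ :=
  P.genBound n + P.advBound A n + P.signBound A n + 2

theorem gen_clock (P : SignatureScheme ℓ) (n : ℕ) :
    P.gen.clock [List.replicate n true] = P.genBound n := by
  simp [PolyTimeAlg.clock, genBound]

theorem length_exptKeys_le (P : SignatureScheme ℓ) (n : ℕ) (ω : CoinSpace) :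
    (P.exptKeys n ω).1.length ≤ P.genBound n ∧ (P.exptKeys n ω).2.length ≤ P.genBound n := by
  rw [← P.gen_clock]
  exact ⟨P.gen.length_cfgString_exec_le _ _ _ _ (by omega) (by simp),
    P.gen.length_cfgString_exec_le _ _ _ _ (by omega) (by simp)⟩

theorem adversary_clock_le (P : SignatureScheme ℓ) (A : PolyTimeAlg) (n : ℕ) (ω : CoinSpace) :
    A.clock [(P.exptKeys n ω).1] ≤ P.advBound A n :=
  A.clock_le (by simpa using (P.length_exptKeys_le n ω).1)

theorem sign_clock_le (P : SignatureScheme ℓ) (A : PolyTimeAlg) (n : ℕ) (ω : CoinSpace) {m : Str}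
    (hm : m.length ≤ P.advBound A n) :
    P.sign.clock [(P.exptKeys n ω).2, m] ≤ P.signBound A n :=
  P.sign.clock_le (by simpa using Nat.add_le_add (P.length_exptKeys_le n ω).2 hm)

theorem length_output_exptAdversary_le (P : SignatureScheme ℓ) (A : PolyTimeAlg) (n : ℕ)
    (G : Str → Str) (ω : CoinSpace) {j : ℕ} (hj : j ≠ 6) (hj' : 1 ≤ j) :
    (cfgString (P.exptAdversary A n G ω) j).length ≤ P.advBound A n :=
  (A.length_cfgString_exec_le _ _ _ _ hj (by simpa using hj')).trans (P.adversary_clock_le A n ω)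

theorem length_request_exptAdversary_le (P : SignatureScheme ℓ) (A : PolyTimeAlg) (n : ℕ)
    (G : Str → Str) (ω : CoinSpace) {j : ℕ} {m : Str}
    (h : (P.exptAdversary A n G ω).2.2[j]? = some m) : m.length ≤ P.advBound A n :=
  (length_of_mem_messages_machineRun A.1 G (P.exptSigner n G ω) (fun t => ω (1, t))
    [(P.exptKeys n ω).1] (by simp) (A.clock [(P.exptKeys n ω).1]) m
    (List.mem_of_getElem? h)).trans (P.adversary_clock_le A n ω)

theorem exptTimes_le (P : SignatureScheme ℓ) (A : PolyTimeAlg) (n : ℕ) (G : Str → Str)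
    (ω : CoinSpace) {t : ℕ} (ht : t ∈ P.exptTimes A n G ω) :
    t ≤ P.advBound A n + P.signBound A n +
      ((P.genBound n + 2 * P.advBound A n) ^ P.vrfy.2 + P.vrfy.2) := by
  rcases ht with rfl | rfl | ⟨j, m, hm, rfl⟩
  · exact (A.time_le_clock _ _ _ _).trans ((P.adversary_clock_le A n ω).trans (by omega))
  · refine (P.vrfy.time_le_clock _ _ _ _).trans ((P.vrfy.clock_le
      (L := P.genBound n + 2 * P.advBound A n) ?_).trans (by omega))
    have h1 := (P.length_exptKeys_le n ω).1
    have h2 := P.length_output_exptAdversary_le A n G ω (j := 3) (by omega) (by omega)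
    have h3 := P.length_output_exptAdversary_le A n G ω (j := 4) (by omega) (by omega)
    simp
    omega
  · exact (P.sign.time_le_clock _ _ _ _).trans ((P.sign_clock_le A n ω
      (P.length_request_exptAdversary_le A n G ω hm)).trans (by omega))

/-- The set of which `maxTime` is the supremum is bounded, so that its supremum is not a junk
value. -/
theorem exptTimes_le_maxTime (P : SignatureScheme ℓ) (A : PolyTimeAlg) (n : ℕ) {G : Str → Str}
    (hG : ∀ x, (G x).length = outLen ℓ n) (ω : CoinSpace) {t : ℕ}
    (ht : t ∈ P.exptTimes A n G ω) : t ≤ P.maxTime A n := by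
  refine le_csSup ⟨P.advBound A n + P.signBound A n +
      ((P.genBound n + 2 * P.advBound A n) ^ P.vrfy.2 + P.vrfy.2), ?_⟩ ⟨G, ω, hG, ht⟩
  rintro _ ⟨G', ω', _, h⟩
  exact P.exptTimes_le A n G' ω' h

/-- The experiment depends only on the values of the hash function at strings of length at most
`maxTime`. -/
theorem sigForge_congr_hash (P : SignatureScheme ℓ) (A : PolyTimeAlg) (n : ℕ) {G G' : Str → Str}
    (hG : ∀ x, (G x).length = outLen ℓ n)
    (h : ∀ x : Str, x.length ≤ P.maxTime A n → G x = G' x) (ω : CoinSpace) :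
    P.SigForge A n G ω ↔ P.SigForge A n G' ω := by
  have hadv : P.exptAdversary A n G ω = P.exptAdversary A n G' ω := by
    refine A.exec_congr_hash _ _ (by simp)
      (fun x hx => h x (hx.trans (P.exptTimes_le_maxTime A n hG ω (Or.inl rfl)))) ?_
    intro j m hm
    have : P.sign.exec G noSign (fun t => ω (j + 2, t)) [(P.exptKeys n ω).2, m] =
        P.sign.exec G' noSign (fun t => ω (j + 2, t)) [(P.exptKeys n ω).2, m] :=
      P.sign.exec_congr_hash _ _ (by simp) (fun x hx => h x (hx.trans
        (P.exptTimes_le_maxTime A n hG ω (Or.inr (Or.inr ⟨j, m, hm, rfl⟩))))) (fun _ _ _ => rfl)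
    simp only [exptSigner, signOutput, this]
  have hv : P.vrfy.exec G noSign (fun _ => false) [(P.exptKeys n ω).1,
        cfgString (P.exptAdversary A n G ω) 3, cfgString (P.exptAdversary A n G ω) 4] =
      P.vrfy.exec G' noSign (fun _ => false) [(P.exptKeys n ω).1,
        cfgString (P.exptAdversary A n G ω) 3, cfgString (P.exptAdversary A n G ω) 4] :=
    P.vrfy.exec_congr_hash _ _ (by simp) (fun x hx => h x (hx.trans
      (P.exptTimes_le_maxTime A n hG ω (Or.inr (Or.inl rfl))))) (fun _ _ _ => rfl)
  simp only [SigForge, Accepts, ← hadv, ← hv]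

/-- The experiment depends only on finitely many coins. -/
theorem sigForge_congr_coins (P : SignatureScheme ℓ) (A : PolyTimeAlg) (n : ℕ) (G : Str → Str)
    {ω ω' : CoinSpace}
    (h : ∀ a b, a < P.coinBound A n → b < P.coinBound A n → ω (a, b) = ω' (a, b)) :
    P.SigForge A n G ω ↔ P.SigForge A n G ω' := by
  have hB : P.coinBound A n = P.genBound n + P.advBound A n + P.signBound A n + 2 := rfl
  have hkeys : P.exptKeys n ω = P.exptKeys n ω' := by
    have : P.gen.exec noHash noSign (fun t => ω (0, t)) [List.replicate n true] =
        P.gen.exec noHash noSign (fun t => ω' (0, t)) [List.replicate n true] :=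
      P.gen.exec_congr_coins _ _ _ fun t ht => h 0 t (by omega) (by rw [gen_clock] at ht; omega)
    simp only [exptKeys, genKeys, this]
  have hadv : P.exptAdversary A n G ω = P.exptAdversary A n G ω' := by
    unfold exptAdversary
    rw [← hkeys]
    have hcl := P.adversary_clock_le A n ω
    refine machineRun_congr A.1 _ _ (fun t ht => h 1 t (by omega) (by omega))
      (fun _ _ _ => rfl) (fun t ht _ => ?_) _ le_rfl
    have h1 := length_messages_machineRun_le A.1 G (P.exptSigner n G ω) (fun t => ω (1, t))
      [(P.exptKeys n ω).1] t
    have h2 := length_cfgString_machineRun_le A.1 G (P.exptSigner n G ω) (fun t => ω (1, t))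
      [(P.exptKeys n ω).1] (j := 5) (by omega) (by simp) t
    simp only [exptSigner, signOutput, ← hkeys]
    rw [P.sign.exec_congr_coins _ _ _ fun s hs => h _ s (by omega) ?_]
    have := P.sign_clock_le A n ω (h2.trans (by omega))
    omega
  simp only [SigForge, ← hadv, ← hkeys]

end SignatureScheme

/-! ### The probability of a forgery as a finite count -/

/-- The coins that are read off from the binary digits of a number. -/
def natCoins (c : ℕ) : CoinSpace := fun p => c.testBit (Nat.pair p.1 p.2)

theorem coinMeasure_cylinder (M c : ℕ) :
    coinMeasure.real {ω | ∀ k < M, ω (Nat.unpair k) = c.testBit k} = 1 / 2 ^ M := by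
  classical
  have hset : {ω : CoinSpace | ∀ k < M, ω (Nat.unpair k) = c.testBit k} =
      Set.pi ((Finset.range M).image Nat.unpair : Finset (ℕ × ℕ))
        (fun p => {c.testBit (Nat.pair p.1 p.2)}) := by
    ext ω
    simp [Set.mem_pi]
  have hinj : Function.Injective Nat.unpair := fun a b h => by
    rw [← Nat.pair_unpair a, ← Nat.pair_unpair b, h]
  rw [hset, MeasureTheory.measureReal_def, coinMeasure,
    MeasureTheory.Measure.infinitePi_pi _ (fun _ _ => MeasurableSet.of_discrete)]
  simp [Finset.card_image_of_injective _ hinj]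

/-- An event that depends only on the coins with numbers below `M` has the probability
`N / 2 ^ M`, where `N` is the number of the favourable outcomes of these `M` coins. -/
theorem coinMeasure_eq_count (E : Set CoinSpace) (M : ℕ)
    (hE : ∀ ω ω' : CoinSpace, (∀ k < M, ω (Nat.unpair k) = ω' (Nat.unpair k)) →
      (ω ∈ E ↔ ω' ∈ E)) [DecidablePred fun c => natCoins c ∈ E] :
    coinMeasure.real E =
      (((Finset.range (2 ^ M)).filter fun c => natCoins c ∈ E).card : ℝ) / 2 ^ M := by
  have hnat : ∀ c k, natCoins c (Nat.unpair k) = c.testBit k := fun c k => by simp [natCoins]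
  have hset : E = ⋃ c ∈ (Finset.range (2 ^ M)).filter (fun c => natCoins c ∈ E),
      {ω : CoinSpace | ∀ k < M, ω (Nat.unpair k) = c.testBit k} := by
    ext ω
    simp only [Set.mem_iUnion, Finset.mem_filter, Finset.mem_range, Set.mem_ofPred_eq, exists_prop]
    constructor
    · intro hω
      have hbits : ∀ k < M, ω (Nat.unpair k) =
          (Nat.ofBits fun i : Fin M => ω (Nat.unpair i)).testBit k := fun k hk => by
        rw [Nat.testBit_ofBits_lt _ _ hk]
      refine ⟨_, ⟨Nat.ofBits_lt_two_pow _, (hE _ _ fun k hk => ?_).1 hω⟩, hbits⟩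
      rw [hnat, hbits k hk]
    · rintro ⟨c, ⟨_, hc⟩, h⟩
      exact (hE _ _ fun k hk => by rw [hnat, h k hk]).1 hc
  have hdisj : Set.PairwiseDisjoint
      (((Finset.range (2 ^ M)).filter fun c => natCoins c ∈ E : Finset ℕ) : Set ℕ)
      (fun c => {ω : CoinSpace | ∀ k < M, ω (Nat.unpair k) = c.testBit k}) := by
    intro c hc c' hc' hne
    refine Set.disjoint_left.2 fun ω h h' => hne (Nat.eq_of_testBit_eq fun k => ?_)
    simp only [Finset.coe_filter, Finset.mem_range, Set.mem_ofPred_eq] at hc hc'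
    by_cases hk : k < M
    · rw [← h k hk, ← h' k hk]
    · have h2 : 2 ^ M ≤ 2 ^ k := Nat.pow_le_pow_right (by omega) (by omega)
      rw [Nat.testBit_lt_two_pow (hc.1.trans_le h2), Nat.testBit_lt_two_pow (hc'.1.trans_le h2)]
  have hmeas : ∀ c : ℕ, MeasurableSet
      {ω : CoinSpace | ∀ k < M, ω (Nat.unpair k) = c.testBit k} := fun c => by
    have : {ω : CoinSpace | ∀ k < M, ω (Nat.unpair k) = c.testBit k} =
        ⋂ k, ⋂ _ : k < M, (fun ω : CoinSpace => ω (Nat.unpair k)) ⁻¹' {c.testBit k} := by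
      ext ω; simp
    rw [this]
    exact MeasurableSet.iInter fun k => MeasurableSet.iInter fun _ =>
      measurable_pi_apply _ MeasurableSet.of_discrete
  have : MeasureTheory.IsProbabilityMeasure coinMeasure := by
    unfold coinMeasure; infer_instance
  conv_lhs => rw [hset]
  rw [MeasureTheory.measureReal_biUnion_finset hdisj fun c _ => hmeas c]
  simp only [coinMeasure_cylinder, Finset.sum_const, nsmul_eq_mul]
  ring

namespace SignatureScheme

variable {ℓ : Polynomial ℤ}

theorem forgeProb_eq_count (P : SignatureScheme ℓ) (A : PolyTimeAlg) (n : ℕ) (G : Str → Str)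
    [DecidablePred fun c => P.SigForge A n G (natCoins c)] :
    P.forgeProb A n G = (((Finset.range (2 ^ (P.coinBound A n) ^ 2)).filter
      fun c => P.SigForge A n G (natCoins c)).card : ℝ) / 2 ^ (P.coinBound A n) ^ 2 := by
  refine coinMeasure_eq_count {ω | P.SigForge A n G ω} _ fun ω ω' h =>
    P.sigForge_congr_coins A n G fun a b ha hb => ?_
  have := h (Nat.pair a b) ((Nat.pair_lt_max_add_one_sq a b).trans_le
    (Nat.pow_le_pow_left (by omega) 2))
  simpa using this

theorem forgeProb_nonneg (P : SignatureScheme ℓ) (A : PolyTimeAlg) (n : ℕ) (G : Str → Str) :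
    0 ≤ P.forgeProb A n G := MeasureTheory.measureReal_nonneg

end SignatureScheme

/-! ### A hash function that defeats finitely many adversaries -/

/-- Averaging over all functions on a larger set does not change the average of a quantity that
depends only on the restriction to a smaller set. -/
theorem average_comp_embedding {α β V : Type*} [Fintype α] [DecidableEq α] [Fintype β]
    [DecidableEq β] [Fintype V] [Nonempty V] (e : α ↪ β) (F : (α → V) → ℝ) :
    1 / (Fintype.card (β → V) : ℝ) * ∑ G : β → V, F (fun a => G (e a)) =
      1 / (Fintype.card (α → V) : ℝ) * ∑ G : α → V, F G := by
  classical
  let p : β → Prop := fun b => b ∈ Set.range e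
  let E : (β → V) ≃ (α → V) × ({b // ¬ p b} → V) :=
    (Equiv.piEquivPiSubtypeProd p fun _ => V).trans
      (Equiv.prodCongr ((Equiv.ofInjective e e.injective).arrowCongr (Equiv.refl V)).symm
        (Equiv.refl _))
  have hE : ∀ G : β → V, (fun a => G (e a)) = (E G).1 := fun G => by
    funext a
    simp [E, p, Equiv.arrowCongr, Equiv.piEquivPiSubtypeProd]
  have hcard : (Fintype.card (β → V) : ℝ) =
      Fintype.card (α → V) * Fintype.card ({b // ¬ p b} → V) := by
    rw [Fintype.card_congr E, Fintype.card_prod]; push_cast; rfl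
  have h0 : (Fintype.card ({b // ¬ p b} → V) : ℝ) ≠ 0 := by
    exact_mod_cast Fintype.card_ne_zero
  simp only [hE]
  rw [E.sum_comp (fun x => F x.1), Fintype.sum_prod_type, hcard]
  simp only [Finset.sum_const, Finset.card_univ, nsmul_eq_mul, ← Finset.mul_sum]
  field_simp

theorem FuncLE.length_toOracle {q m : ℕ} (G : FuncLE q m) (x : Str) :
    (G.toOracle x).length = m := by
  unfold FuncLE.toOracle
  split_ifs <;> simp

namespace SignatureScheme

variable {ℓ : Polynomial ℤ}

/-- The average success probability over the functions on `{0,1}^{≤ q}` is the same for all `q`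
that are at least `maxTime`. This allows a common space of hash functions for several
adversaries. -/
theorem average_forgeProb_eq (P : SignatureScheme ℓ) (A : PolyTimeAlg) (n : ℕ) {q : ℕ}
    (hq : P.maxTime A n ≤ q) :
    1 / (Fintype.card (FuncLE q (outLen ℓ n)) : ℝ) *
        ∑ G : FuncLE q (outLen ℓ n), P.forgeProb A n G.toOracle =
      1 / (Fintype.card (FuncLE (P.maxTime A n) (outLen ℓ n)) : ℝ) *
        ∑ G : FuncLE (P.maxTime A n) (outLen ℓ n), P.forgeProb A n G.toOracle := by
  let e : StrLE (P.maxTime A n) ↪ StrLE q :=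
    ⟨fun x => ⟨x.1, x.2.trans hq⟩, fun x y h => Subtype.ext (Subtype.mk.inj h)⟩
  rw [← average_comp_embedding e
    (fun G : FuncLE (P.maxTime A n) (outLen ℓ n) => P.forgeProb A n G.toOracle)]
  congr 1
  refine Finset.sum_congr rfl fun G _ => ?_
  have : ∀ ω, P.SigForge A n G.toOracle ω ↔
      P.SigForge A n (FuncLE.toOracle (fun a => G (e a)) :) ω :=
    P.sigForge_congr_hash A n G.length_toOracle fun x hx => by
      simp only [FuncLE.toOracle, dif_pos hx, dif_pos (hx.trans hq)]
      rfl
  simp only [forgeProb, this]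

/-- The union bound: if the average success probabilities of the adversaries with indices in `s`
are so small that they add up to less than 1 when they are weighted with `n ^ d j`, then one hash
function works for all of them. -/
theorem exists_forall_forgeProb_le (P : SignatureScheme ℓ) {n : ℕ} (hn : 0 < n)
    (s : Finset ℕ) (A : ℕ → PolyTimeAlg) (d : ℕ → ℕ) (ε : ℕ → ℝ)
    (havg : ∀ j ∈ s, 1 / (Fintype.card (FuncLE (P.maxTime (A j) n) (outLen ℓ n)) : ℝ) *
      ∑ G : FuncLE (P.maxTime (A j) n) (outLen ℓ n), P.forgeProb (A j) n G.toOracle ≤ ε j)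
    (hε : ∑ j ∈ s, (n : ℝ) ^ d j * ε j < 1) :
    ∃ (q : ℕ) (G : FuncLE q (outLen ℓ n)), ∀ j ∈ s,
      P.forgeProb (A j) n G.toOracle ≤ 1 / (n : ℝ) ^ d j := by
  refine ⟨s.sup fun j => P.maxTime (A j) n, ?_⟩
  set q := s.sup fun j => P.maxTime (A j) n with hq
  by_contra! hcon
  have hpos : ∀ j, 0 < (n : ℝ) ^ d j := fun j => by positivity
  have h1 : ∀ G : FuncLE q (outLen ℓ n),
      1 ≤ ∑ j ∈ s, (n : ℝ) ^ d j * P.forgeProb (A j) n G.toOracle := fun G => by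
    obtain ⟨j, hj, hlt⟩ := hcon G
    refine le_trans ?_ (Finset.single_le_sum (fun j _ => mul_nonneg (hpos j).le
      (P.forgeProb_nonneg _ _ _)) hj)
    rw [div_lt_iff₀ (hpos j)] at hlt
    linarith
  have hcard : (0 : ℝ) < Fintype.card (FuncLE q (outLen ℓ n)) := by
    have : Nonempty (FuncLE q (outLen ℓ n)) := ⟨fun _ => List.Vector.replicate _ false⟩
    exact_mod_cast Fintype.card_pos
  have h2 : (1 : ℝ) ≤ 1 / (Fintype.card (FuncLE q (outLen ℓ n)) : ℝ) *
      ∑ G : FuncLE q (outLen ℓ n), ∑ j ∈ s, (n : ℝ) ^ d j * P.forgeProb (A j) n G.toOracle := by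
    rw [one_div, ← div_eq_inv_mul, le_div_iff₀ hcard]
    calc 1 * (Fintype.card (FuncLE q (outLen ℓ n)) : ℝ)
        = ∑ _G : FuncLE q (outLen ℓ n), (1 : ℝ) := by simp
      _ ≤ _ := Finset.sum_le_sum fun G _ => h1 G
  have h3 : 1 / (Fintype.card (FuncLE q (outLen ℓ n)) : ℝ) *
      ∑ G : FuncLE q (outLen ℓ n), ∑ j ∈ s, (n : ℝ) ^ d j * P.forgeProb (A j) n G.toOracle =
      ∑ j ∈ s, (n : ℝ) ^ d j * (1 / (Fintype.card (FuncLE q (outLen ℓ n)) : ℝ) *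
        ∑ G : FuncLE q (outLen ℓ n), P.forgeProb (A j) n G.toOracle) := by
    rw [Finset.sum_comm, Finset.mul_sum]
    refine Finset.sum_congr rfl fun j _ => ?_
    rw [← Finset.mul_sum]
    ring
  rw [h3] at h2
  refine absurd (h2.trans (Finset.sum_le_sum fun j hj => ?_)) (not_le.2 hε)
  rw [P.average_forgeProb_eq (A j) n (Finset.le_sup (f := fun j => P.maxTime (A j) n) hj)]
  exact mul_le_mul_of_nonneg_left (havg j hj) (hpos j).le

end SignatureScheme

/-! ### Executions of machines are primitive recursive -/

section PrimrecBasics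

variable {α β γ : Type*} [Primcodable α] [Primcodable β] [Primcodable γ]

theorem Primrec.natPow : Primrec₂ ((· ^ ·) : ℕ → ℕ → ℕ) :=
  Primrec₂.unpaired'.1 Nat.Primrec.pow

theorem Primrec.natTestBit : Primrec₂ Nat.testBit := by
  have h : PrimrecPred fun p : ℕ × ℕ => p.1 / 2 ^ p.2 % 2 = 1 :=
    Primrec.eq.comp (Primrec.nat_mod.comp (Primrec.nat_div.comp Primrec.fst
      (Primrec.natPow.comp (Primrec.const 2) Primrec.snd)) (Primrec.const 2)) (Primrec.const 1)
  refine Primrec.of_eq (primrecPred_iff_primrec_decide.1 h) fun p => ?_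
  rw [Nat.testBit_eq_decide_div_mod_eq]

theorem Primrec.listReplicate (b : β) : Primrec fun n : ℕ => List.replicate n b :=
  (Primrec.list_map Primrec.list_range (Primrec.const b).to₂).of_eq fun n => by
    simp [List.map_const']

theorem Primrec.list_headD (d : β) : Primrec fun l : List β => l.headD d :=
  (Primrec.option_getD.comp Primrec.list_head? (Primrec.const d)).of_eq fun l => by
    cases l <;> rfl

theorem Primrec.listSet {l : α → List β} {b : α → β} (k : ℕ) (hl : Primrec l) (hb : Primrec b) :
    Primrec fun a => (l a).set k (b a) :=
  Primrec.list_set.comp hl (Primrec.pair (Primrec.const k) hb)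

theorem Primrec.list_sum : Primrec fun l : List ℕ => l.sum :=
  (Primrec.list_foldr Primrec.id (Primrec.const 0)
    (Primrec.nat_add.comp (Primrec.fst.comp Primrec.snd)
      (Primrec.snd.comp Primrec.snd)).to₂).of_eq fun l => by rw [id, List.sum]

theorem Primrec.lookup [BEq β] [LawfulBEq β] {k : α → β} {l : α → List (β × γ)}
    (hk : Primrec k) (hl : Primrec l) : Primrec fun a => (l a).lookup (k a) := by
  classical
  refine (Primrec.listLookup.comp hk hl).of_eq fun a => ?_
  congr 1
  exact lawful_beq_subsingleton _ _

end PrimrecBasics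

theorem primrec_tapeRead : Primrec tapeRead :=
  (Primrec.list_headD none).comp Primrec.snd

theorem primrec_tapeWrite : Primrec₂ tapeWrite :=
  Primrec.pair (Primrec.fst.comp Primrec.snd)
    (Primrec.list_cons.comp Primrec.fst (Primrec.list_tail.comp (Primrec.snd.comp Primrec.snd)))

theorem primrec_tapeMove : Primrec₂ tapeMove := by
  have hr : Primrec fun t : Tape => ((t.2.headD none :: t.1, t.2.tail) : Tape) :=
    Primrec.pair (Primrec.list_cons.comp primrec_tapeRead Primrec.fst)
      (Primrec.list_tail.comp Primrec.snd)
  have hl : Primrec fun t : Tape =>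
      (List.casesOn t.1 t (fun a l => (l, a :: t.2)) : Tape) :=
    Primrec.list_casesOn Primrec.fst Primrec.id
      (Primrec.pair (Primrec.snd.comp Primrec.snd)
        (Primrec.list_cons.comp (Primrec.fst.comp Primrec.snd)
          (Primrec.snd.comp Primrec.fst))).to₂
  have h : Primrec fun p : HeadMove × Tape =>
      (Option.casesOn p.1 p.2 (fun b => bif b then (p.2.2.headD none :: p.2.1, p.2.2.tail)
        else List.casesOn p.2.1 p.2 (fun a l => (l, a :: p.2.2))) : Tape) :=
    Primrec.option_casesOn Primrec.fst Primrec.snd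
      (Primrec.cond Primrec.snd (hr.comp (Primrec.snd.comp Primrec.fst))
        (hl.comp (Primrec.snd.comp Primrec.fst))).to₂
  refine h.of_eq fun p => ?_
  obtain ⟨mv, l, r⟩ := p
  match mv, l with
  | none, _ => rfl
  | some true, _ => rfl
  | some false, [] => rfl
  | some false, _ :: _ => rfl

theorem primrec_leadingBits : Primrec leadingBits := by
  have h : Primrec fun l : List TapeSymbol => (l.foldr
      (fun a r => (Option.casesOn a [] (fun b => b :: r) : Str)) [] : Str) :=
    Primrec.list_foldr Primrec.id (Primrec.const [])
      (Primrec.option_casesOn (Primrec.fst.comp Primrec.snd) (Primrec.const [])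
        (Primrec.list_cons.comp Primrec.snd
          (Primrec.snd.comp (Primrec.snd.comp Primrec.fst))).to₂).to₂
  refine h.of_eq fun l => ?_
  induction l with
  | nil => rfl
  | cons a l ih => cases a <;> simp [leadingBits, ih]

theorem primrec_tapeString : Primrec tapeString :=
  primrec_leadingBits.comp
    (Primrec.list_append.comp (Primrec.list_reverse.comp Primrec.fst) Primrec.snd)

theorem primrec_loadTape : Primrec loadTape :=
  Primrec.pair (Primrec.const [])
    (Primrec.list_map Primrec.id (Primrec.option_some.comp Primrec.snd).to₂)

theorem primrec_cfgString (j : ℕ) : Primrec fun c : Cfg => cfgString c j :=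
  primrec_tapeString.comp ((Primrec.list_getD ([], [])).comp
    (Primrec.fst.comp Primrec.snd) (Primrec.const j))

theorem primrec_applyActions : Primrec₂ applyActions := by
  have hg : Primrec fun p : (List Tape × List (TapeSymbol × HeadMove)) × ℕ =>
      p.1.1.getD p.2 ([], []) :=
    (Primrec.list_getD ([], [])).comp (Primrec.fst.comp Primrec.fst) Primrec.snd
  have h : Primrec fun p : List Tape × List (TapeSymbol × HeadMove) =>
      (List.range p.1.length).map fun j => (Option.casesOn p.2[j]? (p.1.getD j ([], []))
        (fun q => tapeMove q.2 (tapeWrite q.1 (p.1.getD j ([], [])))) : Tape) :=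
    Primrec.list_map (Primrec.list_range.comp (Primrec.list_length.comp Primrec.fst))
      (Primrec.option_casesOn
        (Primrec.list_getElem?.comp (Primrec.snd.comp Primrec.fst) Primrec.snd) hg
        (primrec_tapeMove.comp (Primrec.snd.comp Primrec.snd)
          (primrec_tapeWrite.comp (Primrec.fst.comp Primrec.snd)
            (hg.comp Primrec.fst))).to₂).to₂
  refine h.of_eq fun p => ?_
  unfold applyActions
  refine List.map_congr_left fun j _ => ?_
  cases p.2[j]? <;> rfl

section

variable {α : Type*} [Primcodable α] {M : α → Machine} {O : α → Str → Str}
  {S : α → ℕ → Str → Str} {coins : α → ℕ → Bool} {inputs : α → List Str} {t : α → ℕ}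

theorem primrec_machineStep (hM : Primrec M) (hO : Primrec₂ O)
    (hS : Primrec fun p : α × ℕ × Str => S p.1 p.2.1 p.2.2) :
    Primrec fun p : α × Bool × Cfg => machineStep (M p.1) (O p.1) (S p.1) p.2.1 p.2.2 := by
  have hc : Primrec fun p : α × Bool × Cfg => p.2.2 := Primrec.snd.comp Primrec.snd
  have hs : Primrec fun p : α × Bool × Cfg => p.2.2.1 := Primrec.fst.comp hc
  have ht : Primrec fun p : α × Bool × Cfg => p.2.2.2.1 :=
    Primrec.fst.comp (Primrec.snd.comp hc)
  have hm : Primrec fun p : α × Bool × Cfg => p.2.2.2.2 :=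
    Primrec.snd.comp (Primrec.snd.comp hc)
  have hq : Primrec fun p : α × Bool × Cfg => cfgString p.2.2 5 := (primrec_cfgString 5).comp hc
  have hstate : ∀ k, PrimrecPred fun p : α × Bool × Cfg => p.2.2.1 = k := fun k =>
    Primrec.eq.comp hs (Primrec.const k)
  have h2 : Primrec fun p : α × Bool × Cfg =>
      ((3, p.2.2.2.1.set 6 (loadTape (O p.1 (cfgString p.2.2 5))), p.2.2.2.2) : Cfg) :=
    Primrec.pair (Primrec.const 3) (Primrec.pair
      (Primrec.listSet 6 ht (primrec_loadTape.comp (hO.comp Primrec.fst hq))) hm)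
  have h4 : Primrec fun p : α × Bool × Cfg =>
      ((5, p.2.2.2.1.set 6 (loadTape (S p.1 p.2.2.2.2.length (cfgString p.2.2 5))),
        p.2.2.2.2 ++ [cfgString p.2.2 5]) : Cfg) :=
    Primrec.pair (Primrec.const 5) (Primrec.pair
      (Primrec.listSet 6 ht (primrec_loadTape.comp
        (hS.comp (Primrec.pair Primrec.fst (Primrec.pair (Primrec.list_length.comp hm) hq)))))
      (Primrec.list_concat.comp hm hq))
  have hl : Primrec fun p : α × Bool × Cfg =>
      (M p.1).2.lookup (p.2.2.1, p.2.1, p.2.2.2.1.map tapeRead) :=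
    Primrec.lookup (Primrec.pair hs (Primrec.pair (Primrec.fst.comp Primrec.snd)
      (Primrec.list_map ht (primrec_tapeRead.comp Primrec.snd).to₂)))
      (Primrec.snd.comp (hM.comp Primrec.fst))
  have h0 : Primrec fun p : α × Bool × Cfg =>
      (Option.casesOn ((M p.1).2.lookup (p.2.2.1, p.2.1, p.2.2.2.1.map tapeRead)) (1, p.2.2.2)
        (fun q => (q.1, applyActions p.2.2.2.1 q.2, p.2.2.2.2)) : Cfg) :=
    Primrec.option_casesOn hl (Primrec.pair (Primrec.const 1) (Primrec.snd.comp hc))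
      (Primrec.pair (Primrec.fst.comp Primrec.snd)
        (Primrec.pair (primrec_applyActions.comp (ht.comp Primrec.fst)
          (Primrec.snd.comp Primrec.snd)) (hm.comp Primrec.fst))).to₂
  refine (Primrec.ite (hstate 1) hc (Primrec.ite (hstate 2) h2
    (Primrec.ite (hstate 4) h4 h0))).of_eq fun p => ?_
  unfold machineStep
  split_ifs <;> first | rfl | skip
  cases (M p.1).2.lookup (p.2.2.1, p.2.1, p.2.2.2.1.map tapeRead) <;> rfl

theorem primrec_initialCfg (hM : Primrec M) (hi : Primrec inputs) :
    Primrec fun a => initialCfg (M a) (inputs a) :=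
  Primrec.pair (Primrec.const 0) (Primrec.pair
    (Primrec.list_map (Primrec.list_range.comp
      (Primrec.nat_add.comp (Primrec.const 7) (Primrec.fst.comp hM)))
      (primrec_loadTape.comp ((Primrec.list_getD []).comp (hi.comp Primrec.fst)
        Primrec.snd)).to₂) (Primrec.const []))

theorem primrec_machineRun (hM : Primrec M) (hO : Primrec₂ O)
    (hS : Primrec fun p : α × ℕ × Str => S p.1 p.2.1 p.2.2) (hc : Primrec₂ coins)
    (hi : Primrec inputs) (ht : Primrec t) :
    Primrec fun a => machineRun (M a) (O a) (S a) (coins a) (inputs a) (t a) := by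
  have h : Primrec fun a => (Nat.rec (initialCfg (M a) (inputs a))
      (fun n c => machineStep (M a) (O a) (S a) (coins a n) c) (t a) : Cfg) :=
    Primrec.nat_rec' (h := fun a p => machineStep (M a) (O a) (S a) (coins a p.1) p.2)
      ht (primrec_initialCfg hM hi) ((primrec_machineStep hM hO hS).comp
      (Primrec.pair Primrec.fst (Primrec.pair
        (hc.comp Primrec.fst (Primrec.fst.comp Primrec.snd))
        (Primrec.snd.comp Primrec.snd)))).to₂
  refine h.of_eq fun a => ?_
  generalize t a = k
  induction k with
  | zero => rfl
  | succ k ih => simp only [machineRun, ← ih]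

theorem primrec_exec {A : α → PolyTimeAlg} (hA : Primrec A) (hO : Primrec₂ O)
    (hS : Primrec fun p : α × ℕ × Str => S p.1 p.2.1 p.2.2) (hc : Primrec₂ coins)
    (hi : Primrec inputs) :
    Primrec fun a => (A a).exec (O a) (S a) (coins a) (inputs a) := by
  have hk : Primrec fun a => (A a).2 := Primrec.snd.comp hA
  exact primrec_machineRun (Primrec.fst.comp hA) hO hS hc hi
    (Primrec.nat_add.comp (Primrec.natPow.comp (Primrec.list_sum.comp
      (Primrec.list_map hi (Primrec.list_length.comp Primrec.snd).to₂)) hk) hk)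

end

theorem primrec_adversary : Primrec adversary :=
  Primrec.option_getD.comp Primrec.decode (Primrec.const _)

/-! ### Computability of the experiment -/

theorem primrec_outLen (ℓ : Polynomial ℤ) : Primrec (outLen ℓ) := by
  -- The arithmetic of `ℤ` is avoided by writing the polynomial as a difference of two functions
  -- with natural values.
  suffices h : ∃ p q : ℕ → ℕ, Primrec p ∧ Primrec q ∧
      ∀ n : ℕ, ℓ.eval (n : ℤ) = (p n : ℤ) - q n by
    obtain ⟨p, q, hp, hq, h⟩ := h
    refine (Primrec.nat_sub.comp hp hq).of_eq fun n => ?_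
    rw [outLen, h]
    omega
  induction ℓ using Polynomial.induction_on' with
  | add r s hr hs =>
    obtain ⟨p, q, hp, hq, h⟩ := hr
    obtain ⟨p', q', hp', hq', h'⟩ := hs
    refine ⟨_, _, Primrec.nat_add.comp hp hp', Primrec.nat_add.comp hq hq', fun n => ?_⟩
    rw [Polynomial.eval_add, h, h']
    push_cast
    ring
  | monomial k a =>
    have hpow : Primrec fun n : ℕ => n ^ k := Primrec.natPow.comp Primrec.id (Primrec.const k)
    refine ⟨_, _, Primrec.nat_mul.comp (Primrec.const a.toNat) hpow,
      Primrec.nat_mul.comp (Primrec.const (-a).toNat) hpow, fun n => ?_⟩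
    rw [Polynomial.eval_monomial]
    push_cast
    rw [← sub_mul, Int.toNat_sub_toNat_neg]

theorem primrec_natCoins : Primrec₂ natCoins :=
  Primrec.natTestBit.comp Primrec.fst (Primrec₂.natPair.comp (Primrec.fst.comp Primrec.snd)
    (Primrec.snd.comp Primrec.snd))

namespace SignatureScheme

variable {ℓ : Polynomial ℤ} {α : Type*} [Primcodable α] {A : α → PolyTimeAlg} {n : α → ℕ}
  {G : α → Str → Str} {ω : α → CoinSpace}

theorem primrec_coinBound (P : SignatureScheme ℓ) (hA : Primrec A) (hn : Primrec n) :
    Primrec fun a => P.coinBound (A a) (n a) := by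
  have hpow : ∀ {f g : α → ℕ}, Primrec f → Primrec g → Primrec fun a => f a ^ g a + g a :=
    fun hf hg => Primrec.nat_add.comp (Primrec.natPow.comp hf hg) hg
  have h1 : Primrec fun a => P.genBound (n a) := hpow hn (Primrec.const _)
  have h2 : Primrec fun a => P.advBound (A a) (n a) := hpow h1 (Primrec.snd.comp hA)
  have h3 : Primrec fun a => P.signBound (A a) (n a) :=
    hpow (Primrec.nat_add.comp h1 h2) (Primrec.const _)
  exact Primrec.nat_add.comp (Primrec.nat_add.comp (Primrec.nat_add.comp h1 h2) h3)
    (Primrec.const 2)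

theorem primrec_exptKeys (P : SignatureScheme ℓ) (hn : Primrec n) (hω : Primrec₂ ω) :
    Primrec fun a => P.exptKeys (n a) (ω a) := by
  have h : Primrec fun a => P.gen.exec noHash noSign (fun t => ω a (0, t))
      [List.replicate (n a) true] :=
    primrec_exec (Primrec.const P.gen) (Primrec.const []).to₂ (Primrec.const [])
      (hω.comp Primrec.fst (Primrec.pair (Primrec.const 0) Primrec.snd)).to₂
      (Primrec.list_cons.comp ((Primrec.listReplicate true).comp hn) (Primrec.const []))
  exact Primrec.pair ((primrec_cfgString 3).comp h) ((primrec_cfgString 4).comp h)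

theorem primrec_exptSigner (P : SignatureScheme ℓ) (hn : Primrec n) (hG : Primrec₂ G)
    (hω : Primrec₂ ω) :
    Primrec fun p : α × ℕ × Str => P.exptSigner (n p.1) (G p.1) (ω p.1) p.2.1 p.2.2 := by
  have hsk : Primrec fun p : α × ℕ × Str => (P.exptKeys (n p.1) (ω p.1)).2 :=
    Primrec.snd.comp ((P.primrec_exptKeys hn hω).comp Primrec.fst)
  exact (primrec_cfgString 3).comp (primrec_exec (Primrec.const P.sign)
    (hG.comp (Primrec.fst.comp Primrec.fst) Primrec.snd).to₂ (Primrec.const [])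
    (hω.comp (Primrec.fst.comp Primrec.fst) (Primrec.pair
      (Primrec.nat_add.comp (Primrec.fst.comp (Primrec.snd.comp Primrec.fst)) (Primrec.const 2))
      Primrec.snd)).to₂
    (Primrec.list_cons.comp hsk (Primrec.list_cons.comp (Primrec.snd.comp Primrec.snd)
      (Primrec.const []))))

theorem primrecPred_sigForge (P : SignatureScheme ℓ) (hA : Primrec A) (hn : Primrec n)
    (hG : Primrec₂ G) (hω : Primrec₂ ω) :
    PrimrecPred fun a => P.SigForge (A a) (n a) (G a) (ω a) := by
  have hpk : Primrec fun a => (P.exptKeys (n a) (ω a)).1 :=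
    Primrec.fst.comp (P.primrec_exptKeys hn hω)
  have hadv : Primrec fun a => P.exptAdversary (A a) (n a) (G a) (ω a) :=
    primrec_exec hA hG (P.primrec_exptSigner hn hG hω)
      (hω.comp Primrec.fst (Primrec.pair (Primrec.const 1) Primrec.snd)).to₂
      (Primrec.list_cons.comp hpk (Primrec.const []))
  have h3 := (primrec_cfgString 3).comp hadv
  have h4 := (primrec_cfgString 4).comp hadv
  have hv := (primrec_cfgString 3).comp (primrec_exec (Primrec.const P.vrfy) hG
    (S := fun _ => noSign) (Primrec.const []) (coins := fun _ _ => false) (Primrec.const false).to₂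
    (Primrec.list_cons.comp hpk (Primrec.list_cons.comp h3 (Primrec.list_cons.comp h4
      (Primrec.const [])))))
  have hmem : PrimrecPred fun a => cfgString (P.exptAdversary (A a) (n a) (G a) (ω a)) 3 ∈
      (P.exptAdversary (A a) (n a) (G a) (ω a)).2.2 :=
    ((PrimrecRel.exists_mem_list (R := fun x y : Str => x = y) Primrec.eq).comp
      (Primrec.snd.comp (Primrec.snd.comp hadv)) h3).of_eq fun a => by simp
  exact hmem.not.and (Primrec.eq.comp hv (Primrec.const [true]))

/-- The inequality `forgeProb ≤ n ^ (-d)` can be decided. -/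
theorem primrecPred_forgeProb_le (P : SignatureScheme ℓ) (hA : Primrec A) (hn : Primrec n)
    (hG : Primrec₂ G) {d : α → ℕ} (hd : Primrec d) :
    PrimrecPred fun a => 0 < n a → P.forgeProb (A a) (n a) (G a) ≤ 1 / (n a : ℝ) ^ d a := by
  classical
  have hR : PrimrecRel fun (c : ℕ) (a : α) => P.SigForge (A a) (n a) (G a) (natCoins c) :=
    P.primrecPred_sigForge (hA.comp Primrec.snd) (hn.comp Primrec.snd)
      (hG.comp (Primrec.snd.comp Primrec.fst) Primrec.snd).to₂
      (primrec_natCoins.comp (Primrec.fst.comp Primrec.fst) Primrec.snd).to₂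
  have hM : Primrec fun a => 2 ^ P.coinBound (A a) (n a) ^ 2 :=
    Primrec.natPow.comp (Primrec.const 2)
      (Primrec.natPow.comp (P.primrec_coinBound hA hn) (Primrec.const 2))
  have hcount : Primrec fun a => ((List.range (2 ^ P.coinBound (A a) (n a) ^ 2)).filter
      fun c => P.SigForge (A a) (n a) (G a) (natCoins c)).length :=
    Primrec.list_length.comp (hR.listFilter.comp (Primrec.list_range.comp hM) Primrec.id)
  have hle : PrimrecPred fun a => ((List.range (2 ^ P.coinBound (A a) (n a) ^ 2)).filter
      fun c => P.SigForge (A a) (n a) (G a) (natCoins c)).length * n a ^ d a ≤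
        2 ^ P.coinBound (A a) (n a) ^ 2 :=
    Primrec.nat_le.comp (Primrec.nat_mul.comp hcount (Primrec.natPow.comp hn hd)) hM
  refine ((Primrec.eq.comp hn (Primrec.const 0)).or hle).of_eq fun a => ?_
  rcases Nat.eq_zero_or_pos (n a) with h0 | h0
  · simp [h0]
  simp only [h0.ne', false_or, h0, true_imp_iff]
  have hn0 : (0 : ℝ) < (n a : ℝ) ^ d a := by positivity
  rw [P.forgeProb_eq_count, div_le_div_iff₀ (by positivity) hn0, one_mul]
  exact_mod_cast Iff.rfl

end SignatureScheme

/-! ### Searching for the hash function -/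

/-- The oracle given by a finite table. An answer is cut or filled up with zeros to the length
`m`; strings that are not in the table get the answer `0^m`. -/
def tableOracle (m : ℕ) (T : List (Str × Str)) (x : Str) : Str :=
  ((T.lookup x).getD [] ++ List.replicate m false).take m

theorem length_tableOracle (m : ℕ) (T : List (Str × Str)) (x : Str) :
    (tableOracle m T x).length = m := by
  simp [tableOracle]

theorem FuncLE.exists_tableOracle_eq {q m : ℕ} (G : FuncLE q m) :
    ∃ T, tableOracle m T = G.toOracle := by
  refine ⟨((Finset.univ : Finset (StrLE q)).toList.map Subtype.val).map
    fun x => (x, G.toOracle x), ?_⟩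
  funext x
  by_cases hx : x.length ≤ q
  · have h : x ∈ (Finset.univ : Finset (StrLE q)).toList.map Subtype.val := by simpa using hx
    rw [tableOracle, List.lookup_graph _ h, Option.getD_some]
    exact List.take_left' (G.length_toOracle x)
  · have h : List.lookup x (((Finset.univ : Finset (StrLE q)).toList.map Subtype.val).map
        fun x => (x, G.toOracle x)) = none := by
      rw [List.lookup_eq_none_iff]
      rintro ⟨y, z⟩ hy
      simp only [List.mem_map, Prod.mk.injEq, Subtype.exists] at hy
      obtain ⟨_, ⟨y', hy', _, rfl⟩, rfl, _⟩ := hy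
      exact bne_iff_ne.2 fun h : x = y' => hx (h ▸ hy')
    rw [tableOracle, h]
    simp [FuncLE.toOracle, hx]

theorem primrec_tableOracle {α : Type*} [Primcodable α] {m : α → ℕ} {T : α → List (Str × Str)}
    {x : α → Str} (hm : Primrec m) (hT : Primrec T) (hx : Primrec x) :
    Primrec fun a => tableOracle (m a) (T a) (x a) :=
  Primrec.list_take.comp hm (Primrec.list_append.comp
    (Primrec.option_getD.comp (Primrec.lookup hx hT) (Primrec.const []))
    ((Primrec.listReplicate false).comp hm))

theorem SignatureScheme.primrecPred_forgeProb_tableOracle_le {ℓ : Polynomial ℤ}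
    (P : SignatureScheme ℓ) :
    PrimrecPred fun p : (ℕ × List (Str × Str)) × ℕ => 0 < p.1.1 →
      P.forgeProb (adversary (Nat.unpair p.2).1) p.1.1 (tableOracle (outLen ℓ p.1.1) p.1.2) ≤
        1 / (p.1.1 : ℝ) ^ (Nat.unpair p.2).2 := by
  have hn : Primrec fun p : (ℕ × List (Str × Str)) × ℕ => p.1.1 := Primrec.fst.comp Primrec.fst
  have hT : Primrec fun p : (ℕ × List (Str × Str)) × ℕ => p.1.2 := Primrec.snd.comp Primrec.fst
  have hj : Primrec fun p : (ℕ × List (Str × Str)) × ℕ => Nat.unpair p.2 :=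
    Primrec.unpair.comp Primrec.snd
  have hA : Primrec fun p : (ℕ × List (Str × Str)) × ℕ => adversary (Nat.unpair p.2).1 :=
    primrec_adversary.comp (Primrec.fst.comp hj)
  have hG : Primrec₂ fun (p : (ℕ × List (Str × Str)) × ℕ) (x : Str) =>
      tableOracle (outLen ℓ p.1.1) p.1.2 x :=
    primrec_tableOracle ((primrec_outLen ℓ).comp (hn.comp Primrec.fst))
      (hT.comp Primrec.fst) Primrec.snd
  exact P.primrecPred_forgeProb_le hA hn hG (Primrec.snd.comp hj)

/-- Unbounded search for a witness of a decidable property. -/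
theorem Computable.exists_choice {α β : Type*} [Primcodable α] [Primcodable β] {p : α → β → Bool}
    (hp : Computable₂ p) (h : ∀ a, ∃ b, p a b = true) :
    ∃ g : α → β, Computable g ∧ ∀ a, p a (g a) = true := by
  let F : α → ℕ → Option β := fun a k =>
    (Encodable.decode k : Option β).bind fun b => bif p a b then some b else none
  have hF : Computable₂ F :=
    Computable.option_bind (Computable.decode.comp Computable.snd)
      (Computable.cond (hp.comp (Computable.fst.comp Computable.fst) Computable.snd)
        (Computable.option_some.comp Computable.snd) (Computable.const none)).to₂
  have hdom : ∀ a, (Nat.rfindOpt (F a)).Dom := fun a => by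
    obtain ⟨b, hb⟩ := h a
    exact Nat.rfindOpt_dom.2 ⟨Encodable.encode b, b, by simp [F, hb]⟩
  refine ⟨fun a => (Nat.rfindOpt (F a)).get (hdom a),
    (Partrec.rfindOpt hF).of_eq_tot fun a => Part.get_mem _, fun a => ?_⟩
  have key : ∀ k b, F a k = some b → p a b = true := fun k b hk => by
    simp only [F, Option.bind_eq_some_iff] at hk
    obtain ⟨b', _, hb⟩ := hk
    cases hpb : p a b'
    · simp [hpb] at hb
    · simp only [hpb, cond_true, Option.some.injEq] at hb
      rw [← hb, hpb]
  obtain ⟨k, hk⟩ := Nat.rfindOpt_spec (Part.get_mem (hdom a))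
  exact key k _ hk

/-- Bounded universal quantification preserves computability. -/
theorem Computable.all_range {α : Type*} [Primcodable α] {N : α → ℕ} {p : α → ℕ → Bool}
    (hN : Computable N) (hp : Computable₂ p) :
    Computable fun a => (List.range (N a)).all (p a) := by
  have h : Computable fun a => (Nat.rec true (fun j b => b && p a j) (N a) : Bool) :=
    Computable.nat_rec hN (Computable.const true) (Primrec.and.to_comp.comp
      (Computable.snd.comp Computable.snd)
      (hp.comp Computable.fst (Computable.fst.comp Computable.snd))).to₂
  refine h.of_eq fun a => ?_
  generalize N a = k
  induction k with
  | zero => rfl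
  | succ k ih => rw [List.range_succ, List.all_append, ← ih]; simp

/-- If for every `n ≥ 2` some object fulfils the requirements with numbers `j < n` that are due
at `n`, then such objects can be computed from `n`. -/
theorem Computable.exists_choice_of_due {β : Type*} [Primcodable β] {due : ℕ → ℕ → Prop}
    {good : ℕ → β → ℕ → Prop} [∀ n j, Decidable (due n j)] [∀ n T j, Decidable (good n T j)]
    (hdue : Computable₂ fun n j => decide (due n j))
    (hgood : Computable fun p : (ℕ × β) × ℕ => decide (good p.1.1 p.1.2 p.2))
    (h : ∀ n, ∃ T, 2 ≤ n → ∀ j < n, due n j → good n T j) :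
    ∃ T : ℕ → β, Computable T ∧ ∀ n, 2 ≤ n → ∀ j < n, due n j → good n (T n) j := by
  let test : ℕ → β → Bool := fun n T =>
    decide (n < 2) || (List.range n).all fun j => !decide (due n j) || decide (good n T j)
  have htest : ∀ n T, test n T = true ↔ (2 ≤ n → ∀ j < n, due n j → good n T j) := fun n T => by
    simp only [test, Bool.or_eq_true, List.all_eq_true, List.mem_range, Bool.not_eq_true',
      decide_eq_false_iff_not, decide_eq_true_eq, ← imp_iff_not_or]
    rw [or_iff_not_imp_left, not_lt]
  have hsmall : Computable fun p : ℕ × β => decide (p.1 < 2) :=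
    (primrecPred_iff_primrec_decide.1
      (Primrec.nat_lt.comp Primrec.fst (Primrec.const 2))).to_comp
  have hreq : Computable₂ fun (p : ℕ × β) (j : ℕ) =>
      !decide (due p.1 j) || decide (good p.1 p.2 j) :=
    Primrec.or.to_comp.comp (Primrec.not.to_comp.comp
      (hdue.comp (Computable.fst.comp Computable.fst) Computable.snd)) hgood
  have hcomp : Computable₂ test :=
    Primrec.or.to_comp.comp hsmall (Computable.all_range Computable.fst hreq)
  obtain ⟨T, hT, hTtest⟩ := Computable.exists_choice hcomp fun n => by simpa only [htest] using h n
  exact ⟨T, hT, fun n => (htest n (T n)).1 (hTtest n)⟩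

/-! ### Security relative to a computable hash function -/

/-- The weights of the union bound add up to less than 1. -/
theorem sum_pow_mul_le {n : ℕ} (hn : 2 ≤ n) (s : Finset ℕ) (hs : s ⊆ Finset.range n)
    (d : ℕ → ℕ) : ∑ j ∈ s, (n : ℝ) ^ d j * (1 / (n : ℝ) ^ (d j + j + 1)) < 1 := by
  have hn' : (2 : ℝ) ≤ n := by exact_mod_cast hn
  have hterm : ∀ j, (n : ℝ) ^ d j * (1 / (n : ℝ) ^ (d j + j + 1)) ≤ (1 / 2) ^ (j + 1) := by
    intro j
    rw [add_assoc, pow_add, one_div, mul_inv, ← mul_assoc,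
      mul_inv_cancel₀ (by positivity), one_mul, one_div, inv_pow]
    gcongr
  have hgeom : ∀ m : ℕ, ∑ j ∈ Finset.range m, (1 / 2 : ℝ) ^ (j + 1) = 1 - (1 / 2) ^ m := by
    intro m
    induction m with
    | zero => simp
    | succ m ih => rw [Finset.sum_range_succ, ih]; ring
  calc _ ≤ ∑ j ∈ s, (1 / 2 : ℝ) ^ (j + 1) := Finset.sum_le_sum fun j _ => hterm j
    _ ≤ ∑ j ∈ Finset.range n, (1 / 2 : ℝ) ^ (j + 1) :=
      Finset.sum_le_sum_of_subset_of_nonneg hs fun _ _ _ => by positivity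
    _ < 1 := by rw [hgeom]; linarith [show (0 : ℝ) < (1 / 2) ^ n by positivity]

theorem theorem5p1 (ℓ : Polynomial ℤ) (hℓ : ∀ n : ℕ, 0 < n → 0 < ℓ.eval (n : ℤ))
    (P : SignatureScheme ℓ) (hP : P.EffSecureInROM) :
    ∃ H : ℕ → List Bool → List Bool,
      IsEllFunction ℓ H ∧ Computable₂ H ∧ P.EffSecureRelativeTo H := by
  classical
  obtain ⟨f, hf, hfP⟩ := hP
  -- The number `j` codes the pair of an adversary and an exponent. The additional `j + 1` in the
  -- exponent makes the union bound converge.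
  let due : ℕ → ℕ → Prop := fun n j =>
    f (Nat.unpair j).1 ((Nat.unpair j).2 + j + 1) ≤ n
  let good : ℕ → List (Str × Str) → ℕ → Prop := fun n T j => 0 < n →
    P.forgeProb (adversary (Nat.unpair j).1) n (tableOracle (outLen ℓ n) T) ≤
      1 / (n : ℝ) ^ (Nat.unpair j).2
  have hdue : Computable₂ fun n j => decide (due n j) := by
    have hj : Computable fun p : ℕ × ℕ => Nat.unpair p.2 :=
      Computable.unpair.comp Computable.snd
    have hfj : Computable fun p : ℕ × ℕ =>
        f (Nat.unpair p.2).1 ((Nat.unpair p.2).2 + p.2 + 1) :=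
      hf.comp (Computable.fst.comp hj) (Computable.succ.comp
        (Primrec.nat_add.to_comp.comp (Computable.snd.comp hj) Computable.snd))
    exact (primrecPred_iff_primrec_decide.1 Primrec.nat_le).to_comp.comp
      (Computable.pair hfj Computable.fst)
  have hgood : Primrec fun p : (ℕ × List (Str × Str)) × ℕ => decide (good p.1.1 p.1.2 p.2) :=
    primrecPred_iff_primrec_decide.1 P.primrecPred_forgeProb_tableOracle_le
  have hex : ∀ n, ∃ T, 2 ≤ n → ∀ j < n, due n j → good n T j := fun n => by
    by_cases hn : 2 ≤ n
    · have hs : ∀ j ∈ (Finset.range n).filter (due n), due n j := fun j hj =>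
        (Finset.mem_filter.1 hj).2
      obtain ⟨q, G, hG⟩ := P.exists_forall_forgeProb_le (by omega : 0 < n)
        ((Finset.range n).filter (due n)) (fun j => adversary (Nat.unpair j).1)
        (fun j => (Nat.unpair j).2) (fun j => 1 / (n : ℝ) ^ ((Nat.unpair j).2 + j + 1))
        (fun j hj => hfP _ _ n (by omega) (by omega) (hs j hj))
        (sum_pow_mul_le hn _ (Finset.filter_subset _ _) _)
      obtain ⟨T, hT⟩ := G.exists_tableOracle_eq
      refine ⟨T, fun _ j hj hdj _ => ?_⟩
      rw [hT]
      exact hG j (Finset.mem_filter.2 ⟨Finset.mem_range.2 hj, hdj⟩)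
    · exact ⟨[], fun h => absurd h hn⟩
  obtain ⟨T, hT, hTgood⟩ := Computable.exists_choice_of_due hdue hgood.to_comp hex
  -- From this bound on, `n` exceeds the code of the pair, the pair is due at `n`, and `2 ≤ n`.
  refine ⟨fun n => tableOracle (outLen ℓ n) (T n), fun n x => length_tableOracle _ _ _, ?_,
    fun i d => 2 + (Nat.pair i d + 1) + f i (d + Nat.pair i d + 1), ?_, ?_⟩
  · have h : Primrec fun p : (ℕ × List (Str × Str)) × Str =>
        tableOracle (outLen ℓ p.1.1) p.1.2 p.2 :=
      primrec_tableOracle ((primrec_outLen ℓ).comp (Primrec.fst.comp Primrec.fst))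
        (Primrec.snd.comp Primrec.fst) Primrec.snd
    exact h.to_comp.comp (Computable.pair (Computable.pair Computable.fst
      (hT.comp Computable.fst)) Computable.snd)
  · have hpair : Computable fun p : ℕ × ℕ => Nat.pair p.1 p.2 :=
      Primrec₂.natPair.to_comp.comp Computable.fst Computable.snd
    have hadd := Primrec.nat_add.to_comp
    exact hadd.comp (hadd.comp (Computable.const 2) (Computable.succ.comp hpair))
      (hf.comp Computable.fst (Computable.succ.comp (hadd.comp Computable.snd hpair)))
  · intro i d n _ hn hle
    beta_reduce at hle
    have h := hTgood n (by omega) (Nat.pair i d) (by omega)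
      (by simp only [due, Nat.unpair_pair]; omega) hn
    simpa only [Nat.unpair_pair] using h
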